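/- Let $G=(V,E)$ be a simple connected undirected graph with vertex set $\{1,\dots,N\}$, $N\ge 3$, and vertex degrees $d_1,\dots,d_N$. Let $R_{ij}$ be the effective resistance between $i$ and $j$ when every edge is a unit resistor, and let $$R^+(G)=\sum_{i<j}(d_i+d_j)R_{ij}$$ be the additive degree-Kirchhoff index. Let $P=(p(v,w))$ be the transition matrix of the simple random walk on $G$, that is, $p(v,w)=1/d_v$ if $v$ and $w$ are adjacent and $p(v,w)=0$ otherwise, and let $1=\lambda_1>\lambda_2\ge\dots\ge\lambda_N\ge -1$ be its eigenvalues, counted with multiplicity. Put $$k=\left\lfloor\frac{\lambda_2(N-1)+1}{\lambda_2+1}\right\rfloor,\qquad \theta=\lambda_2(N-k-2)-k+2.$$ Then $$R^+(G)\le N\left(\frac{N-k-2}{1-\lambda_2}+\frac k2+\frac1\theta\right)+\frac1{1-\lambda_2}\left(2|E|\sum_{j=1}^N\frac1{d_j}-N\right).$$ -/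

import Mathlib

open scoped Matrix

/-- `v` is an electric potential on `G` (every edge being a unit resistor) when a unit current
enters at `i` and leaves at `j`: by Kirchhoff's and Ohm's laws, the net current
`∑_{u ∼ w} (v w - v u)` out of each vertex `w` is `1` at `i`, `-1` at `j`, and `0` elsewhere
(and identically `0` if `i = j`). -/
def IsUnitCurrentPotential {V : Type*} [Fintype V] [DecidableEq V] (G : SimpleGraph V)
    [DecidableRel G.Adj] (i j : V) (v : V → ℝ) : Prop :=
  G.lapMatrix ℝ *ᵥ v = Pi.single i 1 - Pi.single j 1

/-- The potential drop between `i` and `j` does not depend on the choice of the potential. -/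
theorem IsUnitCurrentPotential.sub_eq_sub {V : Type*} [Fintype V] [DecidableEq V]
    {G : SimpleGraph V} [DecidableRel G.Adj] {i j : V} {v w : V → ℝ}
    (hv : IsUnitCurrentPotential G i j v) (hw : IsUnitCurrentPotential G i j w) :
    v i - v j = w i - w j := by
  have key : v ⬝ᵥ (G.lapMatrix ℝ *ᵥ w) = w ⬝ᵥ (G.lapMatrix ℝ *ᵥ v) := by
    rw [Matrix.dotProduct_mulVec, ← Matrix.mulVec_transpose, (G.isSymm_lapMatrix (R := ℝ)).eq,
      dotProduct_comm]
  rw [hv, hw] at key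
  simpa [dotProduct_sub] using key

/-- In a connected graph a potential exists for every pair of vertices. -/
theorem exists_isUnitCurrentPotential {V : Type*} [Fintype V] [DecidableEq V]
    {G : SimpleGraph V} [DecidableRel G.Adj] (hG : G.Connected) (i j : V) :
    ∃ v, IsUnitCurrentPotential G i j v := by
  -- `L + J`, with `J` the all-ones matrix, is injective, hence surjective
  set L := G.lapMatrix ℝ with hL
  have hones : ∀ v : V → ℝ, ∑ w, (L *ᵥ v) w = 0 := by
    intro v
    have h1 : (fun _ : V => (1 : ℝ)) ⬝ᵥ (L *ᵥ v) = 0 := by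
      rw [Matrix.dotProduct_mulVec, ← Matrix.mulVec_transpose, hL,
        (G.isSymm_lapMatrix (R := ℝ)).eq, G.lapMatrix_mulVec_const_eq_zero, zero_dotProduct]
    simpa [dotProduct] using h1
  have hne : Nonempty V := hG.nonempty
  have hcard : (Fintype.card V : ℝ) ≠ 0 := by exact_mod_cast Fintype.card_ne_zero
  let T : (V → ℝ) →ₗ[ℝ] (V → ℝ) :=
    Matrix.toLin' (L + Matrix.of fun _ _ => (1 : ℝ))
  have hT : ∀ v u, T v u = (L *ᵥ v) u + ∑ w, v w := by
    intro v u
    simp [T, Matrix.mulVec, dotProduct]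
  have hsum : ∀ v, ∑ u, T v u = Fintype.card V * ∑ w, v w := by
    intro v
    simp only [hT, Finset.sum_add_distrib, hones]
    simp
  have hinj : Function.Injective T := by
    rw [injective_iff_map_eq_zero]
    intro v hv
    have hs : ∑ w, v w = 0 := by
      have h := hsum v
      rw [hv] at h
      simpa [hcard] using h.symm
    have hLv : L *ᵥ v = 0 := by
      funext u
      have h := hT v u
      rw [hv, hs] at h
      simpa using h.symm
    have hconst := (G.lapMatrix_mulVec_eq_zero_iff_forall_reachable).1 hLv
    funext u
    have h : ∑ w, v w = Fintype.card V * v u := by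
      rw [Finset.sum_congr rfl fun w _ => hconst w u (hG.preconnected w u)]
      simp
    rw [hs] at h
    simpa [hcard] using h.symm
  obtain ⟨v, hv⟩ := (LinearMap.injective_iff_surjective.1 hinj) (Pi.single i 1 - Pi.single j 1)
  refine ⟨v, ?_⟩
  have hs : ∑ w, v w = 0 := by
    have h := hsum v
    rw [hv] at h
    simpa [hcard] using h.symm
  funext u
  have h := hT v u
  rw [hv, hs, add_zero] at h
  exact h.symm

open Classical in
/-- The effective resistance `R_{ij}` between `i` and `j`, every edge being a unit resistor: the
potential drop from `i` to `j` when a unit current flows from `i` to `j`. (It is `0` by convention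
if no unit current can flow, which happens only in disconnected graphs.) -/
noncomputable def effectiveResistance {V : Type*} [Fintype V] [DecidableEq V] (G : SimpleGraph V)
    [DecidableRel G.Adj] (i j : V) : ℝ :=
  if h : ∃ v, IsUnitCurrentPotential G i j v then h.choose i - h.choose j else 0

theorem effectiveResistance_eq {V : Type*} [Fintype V] [DecidableEq V] {G : SimpleGraph V}
    [DecidableRel G.Adj] {i j : V} {v : V → ℝ} (hv : IsUnitCurrentPotential G i j v) :
    effectiveResistance G i j = v i - v j := by
  have h : ∃ v, IsUnitCurrentPotential G i j v := ⟨v, hv⟩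
  rw [effectiveResistance, dif_pos h]
  exact h.choose_spec.sub_eq_sub hv

/-- The additive degree-Kirchhoff index `R⁺(G) = ∑_{i<j} (d_i + d_j) R_{ij}`. -/
noncomputable def additiveDegreeKirchhoffIndex {N : ℕ} (G : SimpleGraph (Fin N))
    [DecidableRel G.Adj] : ℝ :=
  ∑ i, ∑ j ∈ Finset.Ioi i, ((G.degree i : ℝ) + G.degree j) * effectiveResistance G i j

/-- The transition matrix of the simple random walk on `G`: `p(v, w) = 1 / d_v` if `v` and `w` are
adjacent, and `0` otherwise. -/
noncomputable def transitionMatrix {V : Type*} [Fintype V] (G : SimpleGraph V)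
    [DecidableRel G.Adj] : Matrix V V ℝ :=
  Matrix.of fun v w => if G.Adj v w then 1 / (G.degree v : ℝ) else 0

/-- The real eigenvalues `λ_1 ≥ λ_2 ≥ …` of the transition matrix, repeated according to their
algebraic multiplicity, in decreasing order. -/
noncomputable def transitionEigenvalues {V : Type*} [Fintype V] [DecidableEq V]
    (G : SimpleGraph V) [DecidableRel G.Adj] : List ℝ :=
  (transitionMatrix G).charpoly.roots.sort (· ≥ ·)

/-- All `N` eigenvalues of the transition matrix are real. -/
theorem length_transitionEigenvalues {V : Type*} [Fintype V] [DecidableEq V]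
    (G : SimpleGraph V) [DecidableRel G.Adj] :
    (transitionEigenvalues G).length = Fintype.card V := by
  let D : Matrix V V ℝ := Matrix.diagonal fun v => (√(G.degree v : ℝ))⁻¹
  have h1 : transitionMatrix G = D * (D * G.adjMatrix ℝ) := by
    ext v w
    simp only [transitionMatrix, D, Matrix.diagonal_mul, Matrix.of_apply,
      SimpleGraph.adjMatrix_apply]
    split_ifs
    · rw [mul_one, ← mul_inv, Real.mul_self_sqrt (Nat.cast_nonneg _), one_div]
    · simp
  have h2 : (D * G.adjMatrix ℝ * D).IsHermitian := by
    have hA : (G.adjMatrix ℝ)ᵀ = G.adjMatrix ℝ := G.transpose_adjMatrix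
    rw [Matrix.IsHermitian, Matrix.conjTranspose_eq_transpose_of_trivial, Matrix.transpose_mul,
      Matrix.transpose_mul, hA, Matrix.diagonal_transpose, Matrix.mul_assoc]
  rw [transitionEigenvalues, Multiset.length_sort, h1, Matrix.charpoly_mul_comm,
    h2.roots_charpoly_eq_eigenvalues]
  simp

/-- The second largest eigenvalue `λ_2` of the transition matrix, counted with multiplicity
(the default value `0` is used only if there are fewer than two vertices). -/
noncomputable def secondEigenvalue {V : Type*} [Fintype V] [DecidableEq V]
    (G : SimpleGraph V) [DecidableRel G.Adj] : ℝ :=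
  (transitionEigenvalues G).getD 1 0

/-! With `y a` the degree-orthonormal eigenvectors of the walk, `L y = (1 - λ) D y`, where `D` is
the degree matrix. Expanding a potential in this basis gives R_ij = ∑ (y_a(i) - y_a(j))² / (1 - λ_a)
over the nonconstant eigenvectors. Weighting by d_i and summing over ordered pairs, normalization
and orthogonality to constants leave R⁺ = ∑ (N + 2|E| ∑_v y_a(v)²) / (1 - λ_a).

The two summands are bounded separately. The trace of P is zero, so the remaining N - 1 eigenvalues
lie in [-1, λ₂] with sum -1. The convex sum ∑ 1/(1 - λ_a) is then largest with N-k-2 values at λ₂, k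
at -1 and one at 1-θ. In the other summand each 1/(1 - λ_a) is at most 1/(1 - λ₂), and completeness
gives ∑_a y_a(v)² = 1/d_v; removing the constant eigenvector accounts for the -N. -/

/-! ### Eigenbasis and sorted spectrum of the walk -/

/-- The random walk on a graph without isolated vertices has a basis of eigenvectors which is
orthonormal for the inner product weighted by the degrees. -/
theorem exists_walkEigenbasis {V : Type*} [Fintype V] [DecidableEq V] (G : SimpleGraph V)
    [DecidableRel G.Adj] (hd : ∀ v, 0 < G.degree v) :
    ∃ (lam : V → ℝ) (y : V → V → ℝ),
      (transitionMatrix G).charpoly.roots = Multiset.map lam Finset.univ.val ∧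
      ∑ a, lam a = 0 ∧
      (∀ a v, (G.adjMatrix ℝ *ᵥ y a) v = lam a * (G.degree v * y a v)) ∧
      (∀ a b, ∑ v, (G.degree v : ℝ) * (y a v * y b v) = if a = b then 1 else 0) ∧
      (∀ v w, ∑ a, y a v * y a w = if v = w then 1 / (G.degree v : ℝ) else 0) := by
  have hd' : ∀ v, (0 : ℝ) < G.degree v := fun v => by exact_mod_cast hd v
  -- P = D(DA) with D = diag(d^(-1/2)) shares its characteristic polynomial with the symmetric DAD;
  -- scaling an orthonormal eigenbasis of DAD by `s` gives eigenvectors of P.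
  let s : V → ℝ := fun v => (√(G.degree v : ℝ))⁻¹
  have hs : ∀ v, 0 < s v := fun v => inv_pos.2 (Real.sqrt_pos.2 (hd' v))
  have hss : ∀ v, s v * s v = (G.degree v : ℝ)⁻¹ := fun v => by
    rw [← mul_inv, Real.mul_self_sqrt (hd' v).le]
  have hdss : ∀ v, (G.degree v : ℝ) * (s v * s v) = 1 := fun v => by
    rw [hss, mul_inv_cancel₀ (hd' v).ne']
  let D : Matrix V V ℝ := Matrix.diagonal s
  have hP : transitionMatrix G = D * (D * G.adjMatrix ℝ) := by
    ext v w
    simp only [transitionMatrix, D, Matrix.diagonal_mul, Matrix.of_apply,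
      SimpleGraph.adjMatrix_apply]
    split_ifs
    · rw [mul_one, hss, one_div]
    · simp
  have hS : (D * G.adjMatrix ℝ * D).IsHermitian := by
    have hA : (G.adjMatrix ℝ)ᵀ = G.adjMatrix ℝ := G.transpose_adjMatrix
    rw [Matrix.IsHermitian, Matrix.conjTranspose_eq_transpose_of_trivial, Matrix.transpose_mul,
      Matrix.transpose_mul, hA, Matrix.diagonal_transpose, Matrix.mul_assoc]
  let U : Matrix V V ℝ := hS.eigenvectorUnitary
  have hU1 : ∀ a b, ∑ v, U v a * U v b = if a = b then 1 else 0 := fun a b => by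
    have h := congrFun (congrFun (Unitary.coe_star_mul_self hS.eigenvectorUnitary) a) b
    simpa [U, Matrix.mul_apply, Matrix.one_apply, Matrix.star_apply] using h
  have hU2 : ∀ v w, ∑ a, U v a * U w a = if v = w then 1 else 0 := fun v w => by
    have h := congrFun (congrFun (Unitary.coe_mul_star_self hS.eigenvectorUnitary) v) w
    simpa [U, Matrix.mul_apply, Matrix.one_apply, Matrix.star_apply] using h
  refine ⟨hS.eigenvalues, fun a v => s v * U v a, ?_, ?_, ?_, ?_, ?_⟩
  · rw [hP, Matrix.charpoly_mul_comm, hS.roots_charpoly_eq_eigenvalues]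
    rfl
  · have h := hS.trace_eq_sum_eigenvalues
    have h0 : (D * G.adjMatrix ℝ * D).trace = 0 := by
      refine Finset.sum_eq_zero fun v _ => ?_
      rw [Matrix.diag_apply, Matrix.mul_diagonal, Matrix.diagonal_mul, SimpleGraph.adjMatrix_apply,
        if_neg (G.irrefl), mul_zero, zero_mul]
    rw [h0] at h
    simpa using h.symm
  · intro a v
    have h := congrFun (hS.mulVec_eigenvectorBasis a) v
    have h1 : s v * (G.adjMatrix ℝ *ᵥ fun w => s w * U w a) v = hS.eigenvalues a * U v a := by
      rw [← Matrix.mulVec_mulVec, ← Matrix.mulVec_mulVec, Matrix.mulVec_diagonal] at h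
      have h2 : (D *ᵥ ⇑(hS.eigenvectorBasis a)) = fun w => s w * U w a := by
        funext w
        rw [Matrix.mulVec_diagonal]
        rfl
      rw [h2] at h
      exact h
    have h3 := hdss v
    apply mul_left_cancel₀ (hs v).ne'
    rw [h1]
    linear_combination (-(hS.eigenvalues a * U v a)) * h3
  · intro a b
    rw [← hU1]
    refine Finset.sum_congr rfl fun v _ => ?_
    linear_combination (U v a * U v b) * hdss v
  · intro v w
    have h : ∑ a, s v * U v a * (s w * U w a) = s v * s w * ∑ a, U v a * U w a := by
      rw [Finset.mul_sum]
      exact Finset.sum_congr rfl fun a _ => by ring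
    rw [h, hU2]
    split_ifs with hvw
    · rw [← hvw, mul_one, hss, one_div]
    · simp

/-- The first two entries of a finite family of reals sorted in decreasing order. -/
theorem exists_first_second_of_sort {ι : Type*} [Fintype ι] [DecidableEq ι] (f : ι → ℝ)
    (hι : 2 ≤ Fintype.card ι) :
    ∃ i₀ i₁, i₁ ≠ i₀ ∧
      ((Multiset.map f Finset.univ.val).sort (· ≥ ·)).getD 1 0 = f i₁ ∧
      f i₁ ≤ f i₀ ∧ ∀ i, i ≠ i₀ → f i ≤ f i₁ := by
  set m := Multiset.map f Finset.univ.val with hm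
  have hpw := Multiset.pairwise_sort m (· ≥ ·)
  have heq := Multiset.sort_eq m (· ≥ ·)
  have hlen : (m.sort (· ≥ ·)).length = Fintype.card ι := by
    rw [Multiset.length_sort, hm, Multiset.card_map]; rfl
  match hl : m.sort (· ≥ ·) with
  | [] => rw [hl] at hlen; simp at hlen; omega
  | [x] => rw [hl] at hlen; simp at hlen; omega
  | x :: z :: t =>
    rw [hl] at hpw heq
    have hx : x ∈ m := by rw [← heq]; simp
    obtain ⟨i₀, -, h0⟩ := Multiset.mem_map.1 hx
    have her : Multiset.map f (Finset.univ.erase i₀).val = ((z :: t : List ℝ) : Multiset ℝ) := by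
      have h1 : m = f i₀ ::ₘ Multiset.map f (Finset.univ.erase i₀).val := by
        rw [← Multiset.map_cons, Finset.erase_val, Multiset.cons_erase (Finset.mem_univ_val i₀)]
      rw [← heq, h0, ← Multiset.cons_coe] at h1
      exact ((Multiset.cons_inj_right x).1 h1).symm
    have hz : z ∈ Multiset.map f (Finset.univ.erase i₀).val := by rw [her]; simp
    obtain ⟨i₁, hi₁, h1⟩ := Multiset.mem_map.1 hz
    rw [List.pairwise_cons, List.pairwise_cons] at hpw
    refine ⟨i₀, i₁, Finset.ne_of_mem_erase hi₁, by simp [h1], ?_, ?_⟩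
    · rw [h0, h1]; exact hpw.1 z (by simp)
    · intro i hi
      have h2 : f i ∈ Multiset.map f (Finset.univ.erase i₀).val :=
        Multiset.mem_map_of_mem f (Finset.mem_erase.2 ⟨hi, Finset.mem_univ i⟩ : i ∈ Finset.univ.erase i₀)
      rw [her, Multiset.mem_coe, List.mem_cons] at h2
      rcases h2 with h2 | h2
      · rw [h2, h1]
      · rw [h1]; exact hpw.2.1 _ h2

/-! ### Majorization on an interval -/

/-- The sum of positive parts under a majorization constraint. -/
theorem sum_max_sub_zero_le {ι : Type*} (s : Finset ι) (x : ι → ℝ) {a b t : ℝ} (k : ℤ)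
    (hx : ∀ i ∈ s, a ≤ x i ∧ x i ≤ b) (hat : a ≤ t) (htb : t ≤ b)
    (hsum : ∑ i ∈ s, (x i - t) = ((s.card : ℝ) - 1 - k) * (b - t) - k * (t - a)) :
    ∑ i ∈ s, max (x i - t) 0 ≤ ((s.card : ℝ) - 1 - k) * (b - t) := by
  classical
  have hcard := Finset.card_filter_add_card_filter_not (s := s) (fun i => t < x i)
  -- Either few entries exceed t, each contributing at most b - t, or by integrality at most k do
  -- not; then each positive part is x - t plus a correction of at most t - a for those.
  rcases le_or_gt (((s.filter fun i => t < x i).card : ℤ)) ((s.card : ℤ) - 1 - k) with h | h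
  · have h1 : ∑ i ∈ s, max (x i - t) 0 ≤ ∑ i ∈ s, if t < x i then b - t else 0 := by
      refine Finset.sum_le_sum fun i hi => ?_
      split_ifs with hi'
      · exact max_le (by linarith [(hx i hi).2]) (by linarith)
      · exact max_le (by linarith) le_rfl
    rw [← Finset.sum_filter, Finset.sum_const, nsmul_eq_mul] at h1
    have h' : ((s.filter fun i => t < x i).card : ℝ) ≤ (s.card : ℝ) - 1 - k := by exact_mod_cast h
    exact h1.trans (mul_le_mul_of_nonneg_right h' (by linarith))
  · have h1 : ∑ i ∈ s, max (x i - t) 0 ≤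
        ∑ i ∈ s, ((x i - t) + if ¬ t < x i then t - a else 0) := by
      refine Finset.sum_le_sum fun i hi => ?_
      split_ifs with hi'
      · exact max_le (by linarith) (by linarith)
      · exact max_le (by linarith [(hx i hi).1]) (by linarith [(hx i hi).1])
    rw [Finset.sum_add_distrib, ← Finset.sum_filter, Finset.sum_const, nsmul_eq_mul, hsum] at h1
    have h' : ((s.filter fun i => ¬ t < x i).card : ℝ) ≤ k := by
      have : ((s.filter fun i => ¬ t < x i).card : ℤ) ≤ k := by omega
      exact_mod_cast this
    have h2 := mul_le_mul_of_nonneg_right h' (sub_nonneg.2 hat)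
    linarith

/-- Majorization bound for the convex function `x ↦ 1 / (1 - x)`: the sum is largest when all but
one of the values are at the ends of the interval. -/
theorem sum_one_div_one_sub_le {ι : Type*} (s : Finset ι) (x : ι → ℝ) {a b t : ℝ} (k : ℤ)
    (hx : ∀ i ∈ s, a ≤ x i ∧ x i ≤ b) (hat : a ≤ t) (htb : t ≤ b) (hb : b < 1)
    (hsum : ∑ i ∈ s, x i = ((s.card : ℝ) - 1 - k) * b + k * a + t) :
    ∑ i ∈ s, 1 / (1 - x i) ≤
      ((s.card : ℝ) - 1 - k) * (1 / (1 - b)) + k * (1 / (1 - a)) + 1 / (1 - t) := by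
  have hb0 : 0 < 1 - b := by linarith
  have ht0 : 0 < 1 - t := by linarith
  have ha0 : 0 < 1 - a := by linarith
  -- Slopes of the chords of 1/(1-x) over [a, t] and [t, b]. By convexity the function lies below
  -- this broken line, whose kink at t is the positive-part term.
  set c₁ := 1 / ((1 - a) * (1 - t)) with hc₁
  set c₂ := 1 / ((1 - t) * (1 - b)) with hc₂
  have hc : 0 ≤ c₂ - c₁ := by
    rw [sub_nonneg]
    apply one_div_le_one_div_of_le (by positivity)
    nlinarith
  have hsum' : ∑ i ∈ s, (x i - t) = ((s.card : ℝ) - 1 - k) * (b - t) - k * (t - a) := by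
    rw [Finset.sum_sub_distrib, hsum, Finset.sum_const, nsmul_eq_mul]; ring
  have hpt : ∀ i ∈ s, 1 / (1 - x i) ≤
      1 / (1 - t) + c₁ * (x i - t) + (c₂ - c₁) * max (x i - t) 0 := by
    intro i hi
    obtain ⟨h1, h2⟩ := hx i hi
    have hx0 : 0 < 1 - x i := by linarith
    rcases le_total (x i) t with h | h
    · rw [max_eq_right (by linarith), mul_zero, add_zero]
      have : 1 / (1 - t) + c₁ * (x i - t) - 1 / (1 - x i) =
          (t - x i) * (x i - a) / ((1 - a) * (1 - t) * (1 - x i)) := by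
        rw [hc₁]; field_simp; ring
      have h3 : 0 ≤ (t - x i) * (x i - a) / ((1 - a) * (1 - t) * (1 - x i)) :=
        div_nonneg (mul_nonneg (by linarith) (by linarith)) (by positivity)
      linarith
    · rw [max_eq_left (by linarith)]
      have : 1 / (1 - t) + c₂ * (x i - t) - 1 / (1 - x i) =
          (x i - t) * (b - x i) / ((1 - t) * (1 - b) * (1 - x i)) := by
        rw [hc₂]; field_simp; ring
      have h3 : 0 ≤ (x i - t) * (b - x i) / ((1 - t) * (1 - b) * (1 - x i)) :=
        div_nonneg (mul_nonneg (by linarith) (by linarith)) (by positivity)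
      linarith
  have hmax := mul_le_mul_of_nonneg_left (sum_max_sub_zero_le s x k hx hat htb hsum') hc
  have htot := Finset.sum_le_sum hpt
  rw [Finset.sum_add_distrib, Finset.sum_add_distrib, ← Finset.mul_sum, ← Finset.mul_sum, hsum',
    Finset.sum_const, nsmul_eq_mul] at htot
  have e1 : c₂ * (b - t) = 1 / (1 - b) - 1 / (1 - t) := by rw [hc₂]; field_simp; ring
  have e2 : c₁ * (t - a) = 1 / (1 - t) - 1 / (1 - a) := by rw [hc₁]; field_simp; ring
  refine htot.trans ((add_le_add_right hmax _).trans (le_of_eq ?_))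
  linear_combination ((s.card : ℝ) - 1 - k) * e1 - (k : ℝ) * e2

/-! ### Spectrum of a connected graph -/

/-- Eigenvalues of the random walk lie in `[-1, 1]`. -/
theorem abs_le_one_of_adjMatrix_mulVec_eq {V : Type*} [Fintype V] [DecidableEq V]
    (G : SimpleGraph V) [DecidableRel G.Adj] (hd : ∀ v, 0 < G.degree v) {μ : ℝ} {y : V → ℝ}
    (hy : y ≠ 0) (h : ∀ v, (G.adjMatrix ℝ *ᵥ y) v = μ * (G.degree v * y v)) : |μ| ≤ 1 := by
  obtain ⟨w, hw⟩ := Function.ne_iff.1 hy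
  have : Nonempty V := ⟨w⟩
  -- Maximum principle: the eigenvalue equation is read where |y| is largest.
  obtain ⟨v, hv⟩ := Finite.exists_max fun v => |y v|
  have hyv : 0 < |y v| := (abs_pos.2 hw).trans_le (hv w)
  have hdv : (0 : ℝ) < G.degree v := by exact_mod_cast hd v
  have h1 : |μ| * (G.degree v * |y v|) ≤ 1 * (G.degree v * |y v|) := by
    calc |μ| * (G.degree v * |y v|) = |(G.adjMatrix ℝ *ᵥ y) v| := by
          rw [h, abs_mul, abs_mul, abs_of_pos hdv]
      _ ≤ ∑ u ∈ G.neighborFinset v, |y u| := by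
          rw [SimpleGraph.adjMatrix_mulVec_apply]; exact Finset.abs_sum_le_sum_abs _ _
      _ ≤ ∑ u ∈ G.neighborFinset v, |y v| := Finset.sum_le_sum fun u _ => hv u
      _ = 1 * (G.degree v * |y v|) := by simp
  exact le_of_mul_le_mul_right h1 (by positivity)

/-- The action of the Laplacian on an eigenvector of the random walk. -/
theorem lapMatrix_mulVec_of_adjMatrix_mulVec_eq {V : Type*} [Fintype V] [DecidableEq V]
    (G : SimpleGraph V) [DecidableRel G.Adj] {μ : ℝ} {y : V → ℝ}
    (h : ∀ v, (G.adjMatrix ℝ *ᵥ y) v = μ * (G.degree v * y v)) (v : V) :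
    (G.lapMatrix ℝ *ᵥ y) v = (1 - μ) * (G.degree v * y v) := by
  have := h v
  rw [SimpleGraph.adjMatrix_mulVec_apply] at this
  rw [SimpleGraph.lapMatrix_mulVec_apply, this]
  ring

/-- Spectral data of the random walk on a connected graph: the eigenvalue `1` is simple with
constant eigenvector, all other eigenvalues are at most `λ₂ < 1`, and `λ₂` is one of them. -/
theorem exists_walkEigenbasis_of_connected {V : Type*} [Fintype V] [DecidableEq V]
    (G : SimpleGraph V) [DecidableRel G.Adj] (hG : G.Connected) (hV : 2 ≤ Fintype.card V) :
    ∃ (lam : V → ℝ) (y : V → V → ℝ) (a₀ : V),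
      ∑ a ∈ Finset.univ.erase a₀, lam a = -1 ∧
      (∀ a ∈ Finset.univ.erase a₀, -1 ≤ lam a ∧ lam a ≤ secondEigenvalue G) ∧
      secondEigenvalue G < 1 ∧
      (∀ v, y a₀ v ^ 2 = 1 / ∑ u, (G.degree u : ℝ)) ∧
      (∀ v w, y a₀ v = y a₀ w) ∧
      (∀ a v, (G.lapMatrix ℝ *ᵥ y a) v = (1 - lam a) * (G.degree v * y a v)) ∧
      (∀ a b, ∑ v, (G.degree v : ℝ) * (y a v * y b v) = if a = b then 1 else 0) ∧
      (∀ v w, ∑ a, y a v * y a w = if v = w then 1 / (G.degree v : ℝ) else 0) := by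
  have : Nontrivial V := Fintype.one_lt_card_iff_nontrivial.1 hV
  have hd : ∀ v, 0 < G.degree v := fun v => hG.preconnected.degree_pos_of_nontrivial v
  have hd' : ∀ v, (0 : ℝ) < G.degree v := fun v => by exact_mod_cast hd v
  obtain ⟨lam, y, hroots, htr, hA, horth, hcomp⟩ := exists_walkEigenbasis G hd
  obtain ⟨a₀, a₁, hne, hsec, hle, hmax⟩ := exists_first_second_of_sort lam hV
  have hsec' : secondEigenvalue G = lam a₁ := by
    rw [secondEigenvalue, transitionEigenvalues, hroots, hsec]
  have hy0 : ∀ a, y a ≠ 0 := fun a h0 => by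
    have := horth a a
    simp [h0] at this
  have habs : ∀ a, -1 ≤ lam a ∧ lam a ≤ 1 := fun a =>
    abs_le.1 (abs_le_one_of_adjMatrix_mulVec_eq G hd (hy0 a) (hA a))
  have hL := fun a v => lapMatrix_mulVec_of_adjMatrix_mulVec_eq G (hA a) v
  have hconst : ∀ a, lam a = 1 → ∀ v w, y a v = y a w := fun a ha v w => by
    refine (G.lapMatrix_mulVec_eq_zero_iff_forall_reachable).1 ?_ v w (hG.preconnected v w)
    funext u
    simp [hL, ha]
  have hsq : ∀ a, lam a = 1 → ∀ v, y a v ^ 2 * ∑ u, (G.degree u : ℝ) = 1 := fun a ha v => by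
    have h1 := horth a a
    rw [if_pos rfl] at h1
    rw [← h1, Finset.mul_sum]
    refine Finset.sum_congr rfl fun u _ => ?_
    rw [hconst a ha u v]; ring
  have huniq : ∀ a b, lam a = 1 → lam b = 1 → a = b := fun a b ha hb => by
    by_contra hab
    obtain ⟨v⟩ := hG.nonempty
    have h1 := horth a b
    rw [if_neg hab] at h1
    have h2 : y a v * y b v * ∑ u, (G.degree u : ℝ) = 0 := by
      rw [← h1, Finset.mul_sum]
      refine Finset.sum_congr rfl fun u _ => ?_
      rw [hconst a ha u v, hconst b hb u v]; ring
    have h3 := hsq a ha v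
    have h4 := hsq b hb v
    have h5 : (y a v * y b v * ∑ u, (G.degree u : ℝ)) ^ 2 = 1 := by
      linear_combination (y b v ^ 2 * ∑ u, (G.degree u : ℝ)) * h3 + h4
    rw [h2] at h5
    norm_num at h5
  -- Otherwise every eigenvector would be degree-orthogonal to constants, and the expansion of the
  -- constant 1 would vanish.
  have hex : ∃ a, lam a = 1 := by
    by_contra! hno
    have hperp : ∀ a, ∑ u, (G.degree u : ℝ) * y a u = 0 := fun a => by
      have h1 : ∑ u, (G.lapMatrix ℝ *ᵥ y a) u = 0 := by
        have h2 : (fun _ : V => (1 : ℝ)) ⬝ᵥ (G.lapMatrix ℝ *ᵥ y a) = 0 := by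
          rw [Matrix.dotProduct_mulVec, ← Matrix.mulVec_transpose,
            (G.isSymm_lapMatrix (R := ℝ)).eq, G.lapMatrix_mulVec_const_eq_zero, zero_dotProduct]
        simpa [dotProduct] using h2
      simp only [hL, ← Finset.mul_sum] at h1
      exact (mul_eq_zero.1 h1).resolve_left (sub_ne_zero.2 (hno a).symm)
    obtain ⟨v⟩ := hG.nonempty
    have h1 : ∑ a, (∑ u, (G.degree u : ℝ) * y a u) * y a v = 1 := by
      simp only [Finset.sum_mul]
      rw [Finset.sum_comm]
      have h2 : ∀ u, ∑ a, (G.degree u : ℝ) * y a u * y a v = if u = v then 1 else 0 := fun u => by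
        simp only [mul_assoc, ← Finset.mul_sum, hcomp]
        split_ifs
        · exact mul_one_div_cancel (hd' u).ne'
        · simp
      simp [h2]
    simp [hperp] at h1
  have h0 : lam a₀ = 1 := by
    obtain ⟨a, ha⟩ := hex
    by_cases haa : a = a₀
    · rw [← haa, ha]
    · have h1 := hmax a haa
      exact le_antisymm (habs a₀).2 (by linarith)
  have hlt : lam a₁ < 1 :=
    lt_of_le_of_ne (habs a₁).2 fun h => hne (huniq a₁ a₀ h h0)
  have hpos : 0 < ∑ u, (G.degree u : ℝ) :=
    Finset.sum_pos (fun u _ => hd' u) ⟨a₀, Finset.mem_univ _⟩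
  refine ⟨lam, y, a₀, ?_, ?_, hsec' ▸ hlt, ?_, hconst a₀ h0, hL, horth, hcomp⟩
  · have := Finset.add_sum_erase Finset.univ lam (Finset.mem_univ a₀)
    linarith
  · intro a ha
    exact ⟨(habs a).1, hsec' ▸ hmax a (Finset.ne_of_mem_erase ha)⟩
  · intro v
    rw [eq_div_iff hpos.ne', hsq a₀ h0 v]

/-! ### Resistance and Kirchhoff index as spectral sums -/

/-- Spectral formula for the effective resistance. -/
theorem effectiveResistance_eq_sum {V : Type*} [Fintype V] [DecidableEq V] {G : SimpleGraph V}
    [DecidableRel G.Adj] (hG : G.Connected) (hd : ∀ v, 0 < G.degree v)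
    {lam : V → ℝ} {y : V → V → ℝ} {a₀ : V}
    (hlam : ∀ a ∈ Finset.univ.erase a₀, lam a < 1) (hconst : ∀ v w, y a₀ v = y a₀ w)
    (hL : ∀ a v, (G.lapMatrix ℝ *ᵥ y a) v = (1 - lam a) * (G.degree v * y a v))
    (hcomp : ∀ v w, ∑ a, y a v * y a w = if v = w then 1 / (G.degree v : ℝ) else 0) (i j : V) :
    effectiveResistance G i j =
      ∑ a ∈ Finset.univ.erase a₀, 1 / (1 - lam a) * (y a i - y a j) ^ 2 := by
  obtain ⟨p, hp⟩ := exists_isUnitCurrentPotential hG i j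
  rw [effectiveResistance_eq hp]
  -- Coefficients of the potential in the eigenbasis, found by moving the symmetric Laplacian onto
  -- `y a`.
  have hc : ∀ a, (1 - lam a) * ∑ u, (G.degree u : ℝ) * y a u * p u = y a i - y a j := fun a => by
    have h1 : y a ⬝ᵥ (G.lapMatrix ℝ *ᵥ p) = (G.lapMatrix ℝ *ᵥ y a) ⬝ᵥ p := by
      rw [Matrix.dotProduct_mulVec, ← Matrix.mulVec_transpose, (G.isSymm_lapMatrix (R := ℝ)).eq]
    rw [hp] at h1
    have h2 : y a ⬝ᵥ (Pi.single i 1 - Pi.single j 1) = y a i - y a j := by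
      simp [dotProduct_sub]
    rw [← h2, h1, dotProduct, Finset.mul_sum]
    exact Finset.sum_congr rfl fun u _ => by rw [hL]; ring
  have hexp : ∀ v, ∑ a, (∑ u, (G.degree u : ℝ) * y a u * p u) * y a v = p v := fun v => by
    simp only [Finset.sum_mul]
    rw [Finset.sum_comm]
    have h2 : ∀ u, ∑ a, (G.degree u : ℝ) * y a u * p u * y a v = if u = v then p u else 0 := by
      intro u
      have h3 : ∑ a, (G.degree u : ℝ) * y a u * p u * y a v =
          G.degree u * p u * ∑ a, y a u * y a v := by
        rw [Finset.mul_sum]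
        exact Finset.sum_congr rfl fun a _ => by ring
      have hu : (G.degree u : ℝ) ≠ 0 := by exact_mod_cast (hd u).ne'
      rw [h3, hcomp]
      split_ifs
      · field_simp
      · simp
    simp [h2]
  rw [← hexp i, ← hexp j, ← Finset.sum_sub_distrib,
    ← Finset.add_sum_erase Finset.univ _ (Finset.mem_univ a₀), hconst i j, sub_self, zero_add]
  refine Finset.sum_congr rfl fun a ha => ?_
  have h1 : 1 - lam a ≠ 0 := (sub_pos.2 (hlam a ha)).ne'
  rw [sq, ← hc a]
  field_simp
  rw [← hc a]
  ring

theorem effectiveResistance_self {V : Type*} [Fintype V] [DecidableEq V] (G : SimpleGraph V)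
    [DecidableRel G.Adj] (i : V) : effectiveResistance G i i = 0 := by
  rw [effectiveResistance]
  split_ifs <;> simp

/-- A sum over pairs `i < j` of a symmetrized quantity is a sum over all ordered pairs. -/
theorem sum_Ioi_add_swap {N : ℕ} (f : Fin N → Fin N → ℝ) (hf : ∀ i, f i i = 0) :
    ∑ i, ∑ j ∈ Finset.Ioi i, (f i j + f j i) = ∑ i, ∑ j, f i j := by
  have h1 : ∀ i, ∑ j ∈ Finset.Ioi i, (f i j + f j i) =
      ∑ j, ((if i < j then f i j else 0) + if i < j then f j i else 0) := fun i => by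
    have : Finset.Ioi i = Finset.univ.filter fun j => i < j := by ext; simp
    rw [this, Finset.sum_filter]
    exact Finset.sum_congr rfl fun j _ => by split_ifs <;> simp
  simp only [h1, Finset.sum_add_distrib]
  rw [Finset.sum_comm (f := fun i j => if i < j then f j i else 0), ← Finset.sum_add_distrib]
  refine Finset.sum_congr rfl fun i _ => ?_
  rw [← Finset.sum_add_distrib]
  refine Finset.sum_congr rfl fun j _ => ?_
  rcases lt_trichotomy i j with h | h | h
  · simp [h, h.not_gt]
  · simp [h, hf]
  · simp [h, h.not_gt]

/-- Spectral formula for the additive degree-Kirchhoff index. -/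
theorem additiveDegreeKirchhoffIndex_eq {N : ℕ} {G : SimpleGraph (Fin N)} [DecidableRel G.Adj]
    (hG : G.Connected) (hd : ∀ v, 0 < G.degree v)
    {lam : Fin N → ℝ} {y : Fin N → Fin N → ℝ} {a₀ : Fin N}
    (hlam : ∀ a ∈ Finset.univ.erase a₀, lam a < 1) (hconst : ∀ v w, y a₀ v = y a₀ w)
    (hsq : ∀ v, y a₀ v ^ 2 = 1 / ∑ u, (G.degree u : ℝ))
    (hL : ∀ a v, (G.lapMatrix ℝ *ᵥ y a) v = (1 - lam a) * (G.degree v * y a v))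
    (horth : ∀ a b, ∑ v, (G.degree v : ℝ) * (y a v * y b v) = if a = b then 1 else 0)
    (hcomp : ∀ v w, ∑ a, y a v * y a w = if v = w then 1 / (G.degree v : ℝ) else 0) :
    additiveDegreeKirchhoffIndex G =
      ∑ a ∈ Finset.univ.erase a₀,
        1 / (1 - lam a) * (N + (∑ u, (G.degree u : ℝ)) * ∑ v, y a v ^ 2) := by
  have hR := effectiveResistance_eq_sum hG hd hlam hconst hL hcomp
  have hsymm : ∀ i j, effectiveResistance G i j = effectiveResistance G j i := fun i j => by
    rw [hR, hR]
    exact Finset.sum_congr rfl fun a _ => by ring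
  have h1 : additiveDegreeKirchhoffIndex G =
      ∑ i, ∑ j, (G.degree i : ℝ) * effectiveResistance G i j := by
    rw [← sum_Ioi_add_swap _ fun i => by rw [effectiveResistance_self, mul_zero]]
    refine Finset.sum_congr rfl fun i _ => Finset.sum_congr rfl fun j _ => ?_
    rw [hsymm j i]; ring
  have hperp : ∀ a ∈ Finset.univ.erase a₀, ∑ u, (G.degree u : ℝ) * y a u = 0 := fun a ha => by
    have h2 := horth a a₀
    rw [if_neg (Finset.ne_of_mem_erase ha)] at h2
    have h3 : (∑ u, (G.degree u : ℝ) * y a u) * y a₀ a₀ = 0 := by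
      rw [← h2, Finset.sum_mul]
      exact Finset.sum_congr rfl fun u _ => by rw [hconst u a₀]; ring
    refine (mul_eq_zero.1 h3).resolve_right fun h4 => ?_
    have h5 := hsq a₀
    have hpos : 0 < ∑ u, (G.degree u : ℝ) :=
      Finset.sum_pos (fun u _ => by exact_mod_cast hd u) ⟨a₀, Finset.mem_univ _⟩
    rw [h4] at h5
    have h6 := one_div_pos.2 hpos
    linarith
  rw [h1]
  simp only [hR, Finset.mul_sum]
  have h7 : ∀ i : Fin N, ∑ j, ∑ a ∈ Finset.univ.erase a₀,
      (G.degree i : ℝ) * (1 / (1 - lam a) * (y a i - y a j) ^ 2) =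
      ∑ a ∈ Finset.univ.erase a₀, ∑ j,
        (G.degree i : ℝ) * (1 / (1 - lam a) * (y a i - y a j) ^ 2) := fun i => Finset.sum_comm
  simp only [h7]
  rw [Finset.sum_comm]
  refine Finset.sum_congr rfl fun a ha => ?_
  -- After summation over i, the three terms become N, 2|E| ∑ y² and, by `hperp`, 0.
  have h8 : ∀ i, ∑ j, (G.degree i : ℝ) * (1 / (1 - lam a) * (y a i - y a j) ^ 2) =
      1 / (1 - lam a) * (N * ((G.degree i : ℝ) * (y a i * y a i))
        + (G.degree i : ℝ) * (∑ v, y a v ^ 2)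
        - 2 * ((G.degree i : ℝ) * y a i) * ∑ j, y a j) := fun i => by
    have h9 : ∀ j, (G.degree i : ℝ) * (1 / (1 - lam a) * (y a i - y a j) ^ 2) =
        1 / (1 - lam a) * ((G.degree i : ℝ) * (y a i * y a i)) +
        1 / (1 - lam a) * (G.degree i : ℝ) * y a j ^ 2
        - 1 / (1 - lam a) * (2 * ((G.degree i : ℝ) * y a i)) * y a j := fun j => by ring
    simp only [h9, Finset.sum_sub_distrib, Finset.sum_add_distrib, ← Finset.mul_sum,
      Finset.sum_const, Finset.card_univ, Fintype.card_fin, nsmul_eq_mul]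
    ring
  simp only [h8, ← Finset.mul_sum, Finset.sum_sub_distrib, Finset.sum_add_distrib,
    ← Finset.sum_mul, hperp a ha, horth]
  simp

/-! ### The final estimate -/

theorem mainTheorem6 (N : ℕ) (hN : 3 ≤ N) (G : SimpleGraph (Fin N)) [DecidableRel G.Adj]
    (hG : G.Connected) (lam₂ : ℝ) (hlam₂ : lam₂ = secondEigenvalue G)
    (k : ℤ) (hk : k = ⌊(lam₂ * ((N : ℝ) - 1) + 1) / (lam₂ + 1)⌋)
    (θ : ℝ) (hθ : θ = lam₂ * ((N : ℝ) - k - 2) - k + 2) :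
    additiveDegreeKirchhoffIndex G ≤
      (N : ℝ) * (((N : ℝ) - k - 2) / (1 - lam₂) + (k : ℝ) / 2 + 1 / θ)
        + 1 / (1 - lam₂) *
          (2 * (G.edgeFinset.card : ℝ) * (∑ j, 1 / (G.degree j : ℝ)) - (N : ℝ)) := by
  have hcardV : 2 ≤ Fintype.card (Fin N) := by rw [Fintype.card_fin]; omega
  have : Nontrivial (Fin N) := Fintype.one_lt_card_iff_nontrivial.1 hcardV
  have hd : ∀ v, 0 < G.degree v := fun v => hG.preconnected.degree_pos_of_nontrivial v
  have hd' : ∀ v, (0 : ℝ) < G.degree v := fun v => by exact_mod_cast hd v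
  have hN3 : (3 : ℝ) ≤ N := by exact_mod_cast hN
  obtain ⟨lam, y, a₀, hsum, hbd, hlt, hsq, hconst, hL, horth, hcomp⟩ :=
    exists_walkEigenbasis_of_connected G hG hcardV
  rw [← hlam₂] at hbd hlt
  have hlam : ∀ a ∈ Finset.univ.erase a₀, lam a < 1 := fun a ha => (hbd a ha).2.trans_lt hlt
  have hcard : ((Finset.univ.erase a₀).card : ℝ) = N - 1 := by
    rw [Finset.card_erase_of_mem (Finset.mem_univ _), Finset.card_univ, Fintype.card_fin,
      Nat.cast_sub (by omega), Nat.cast_one]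
  have hlow : 0 ≤ lam₂ * ((N : ℝ) - 1) + 1 := by
    have h1 := Finset.sum_le_sum fun a ha => (hbd a ha).2
    rw [hsum, Finset.sum_const, nsmul_eq_mul, hcard] at h1
    linarith
  -- λ₂ is at least the mean -1/(N-1) of the other eigenvalues, which exceeds -1 because N ≥ 3.
  have hpos : 0 < lam₂ + 1 := by nlinarith
  -- The two floor inequalities say that 1 - θ ≤ λ₂ and 1 - θ > -1, so the leftover value is
  -- admissible.
  have hk1 : (k : ℝ) * (lam₂ + 1) ≤ lam₂ * ((N : ℝ) - 1) + 1 := by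
    rw [← le_div_iff₀ hpos, hk]
    exact Int.floor_le _
  have hk2 : lam₂ * ((N : ℝ) - 1) + 1 < ((k : ℝ) + 1) * (lam₂ + 1) := by
    rw [← div_lt_iff₀ hpos, hk]
    exact Int.lt_floor_add_one _
  have hkem : ∑ a ∈ Finset.univ.erase a₀, 1 / (1 - lam a) ≤
      ((N : ℝ) - k - 2) / (1 - lam₂) + (k : ℝ) / 2 + 1 / θ := by
    have h1 := sum_one_div_one_sub_le (Finset.univ.erase a₀) lam (a := -1) (b := lam₂)
      (t := 1 - θ) k hbd (by rw [hθ]; linarith) (by rw [hθ]; linarith) hlt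
      (by rw [hsum, hcard, hθ]; ring)
    refine h1.trans (le_of_eq ?_)
    rw [hcard, sub_sub_cancel]
    ring
  have hdeg : ∑ u, (G.degree u : ℝ) = 2 * G.edgeFinset.card := by
    exact_mod_cast G.sum_degrees_eq_twice_card_edges
  have hdpos : 0 < ∑ u, (G.degree u : ℝ) :=
    Finset.sum_pos (fun u _ => hd' u) ⟨a₀, Finset.mem_univ _⟩
  have hrest : (∑ u, (G.degree u : ℝ)) * ∑ a ∈ Finset.univ.erase a₀, ∑ v, y a v ^ 2 =
      2 * (G.edgeFinset.card : ℝ) * (∑ j, 1 / (G.degree j : ℝ)) - N := by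
    have h1 := Finset.add_sum_erase Finset.univ (fun a => ∑ v, y a v ^ 2) (Finset.mem_univ a₀)
    have h2 : ∑ a, ∑ v, y a v ^ 2 = ∑ j, 1 / (G.degree j : ℝ) := by
      rw [Finset.sum_comm]
      refine Finset.sum_congr rfl fun v _ => ?_
      simpa [sq] using hcomp v v
    have h3 : (∑ u, (G.degree u : ℝ)) * ∑ v, y a₀ v ^ 2 = N := by
      simp only [hsq, Finset.sum_const, Finset.card_univ, Fintype.card_fin, nsmul_eq_mul]
      field_simp
    rw [h2] at h1
    rw [← hdeg, ← h1]
    linear_combination -h3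
  rw [additiveDegreeKirchhoffIndex_eq hG hd hlam hconst hsq hL horth hcomp]
  simp only [mul_add, Finset.sum_add_distrib, ← Finset.sum_mul]
  rw [← mul_add, ← mul_add, mul_comm _ (N : ℝ)]
  refine add_le_add (mul_le_mul_of_nonneg_left hkem (by linarith)) ?_
  rw [← hrest, Finset.mul_sum, Finset.mul_sum]
  refine Finset.sum_le_sum fun a ha => ?_
  exact mul_le_mul_of_nonneg_right
    (one_div_le_one_div_of_le (by linarith) (by linarith [(hbd a ha).2]))
    (mul_nonneg hdpos.le (Finset.sum_nonneg fun v _ => sq_nonneg _))
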